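/- Let $n\ge 0$ and work in $R=\mathbb{Z}_2[x_1,\dots,x_n]$ with the lexicographical monomial ordering, $x_1>\dots>x_n$. A Boolean polynomial is a polynomial of degree at most one in each variable. Identify a point $v\in\mathbb{Z}_2^n$ with the set $\{i\mid v_i=1\}$, and a Boolean monomial with the set of indices of its variables; thus finite sets of points and Boolean polynomials (as sets of terms) are both families $S$ of subsets of $\{1,\dots,n\}$. Write $S\triangle T$ for the symmetric difference (which is the sum of Boolean polynomials), $S_0=\{s\in S\mid i\notin s\}$ and $S_1=\{s\setminus\{i\}\mid s\in S,\ i\in s\}$ for a given index $i$, and $\mathrm{top}(S)$ for the smallest index occurring in $S$ ($\infty$ if none occurs). For disjoint sets of points $Z,O$, the partial Boolean function $b_Z^O$ is $0$ on $Z$, $1$ on $O$ and undefined elsewhere; the sum of two partial functions is their pointwise sum on the intersection of their domains. Define recursively the following procedures. $\mathrm{zeros}(p,S)$, for a Boolean polynomial $p$ and a set $S$ of points: if $p=0$ return $S$; if $p=1$ or $S=\emptyset$ return $\emptyset$; if $S$ consists of the origin only, return $\emptyset$ if $p$ has a constant term and $S$ otherwise. Otherwise, while $\mathrm{top}(p)<\mathrm{top}(S)$,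 remove from $p$ all terms that contain the variable with index $\mathrm{top}(p)$; then let $i=\min(\mathrm{top}(p),\mathrm{top}(S))$, $Z_{00}=\mathrm{zeros}(p_0,S_0)$, $Z_{01}=\mathrm{zeros}(p_0,S_1)$, $Z_{11}=\mathrm{zeros}(p_1,S_1)$, and return $\{s\cup\{i\}\mid s\in S_1\setminus(Z_{01}\triangle Z_{11})\}\cup Z_{00}$. Put $\mathrm{ones}(p,S)=S\setminus\mathrm{zeros}(p,S)$. $\mathrm{interpolateSmallestLex}(b_Z^O)$: if $O=\emptyset$ return $0$; else if $Z=\emptyset$ return $1$. Otherwise let $i=\min(\mathrm{top}(O),\mathrm{top}(Z))$, $C=(Z_1\cup O_1)\cap(Z_0\cup O_0)$, $h_t=\mathrm{interpolateSmallestLex}(b_{Z_1}^{O_1}+b_{Z_0}^{O_0})$, $F=\mathrm{ones}(h_t,(Z_1\cup O_1)\setminus C)$, $h_e=\mathrm{interpolateSmallestLex}(b_{Z'}^{O'})$ with $Z'=((Z_1\setminus C)\triangle F)\cup Z_0$ and $O'=((O_1\setminus C)\triangle F)\cup O_0$, and return $x_i h_t+h_e$. $\mathrm{nfByInterpolate}(f,P)$,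 for a Boolean polynomial $f$ and a set of points $P\subseteq\mathbb{Z}_2^n$: let $Z=\mathrm{zeros}(f,P)$ and return $\mathrm{interpolateSmallestLex}(b_Z^{P\setminus Z})$. Extend the ordering to Boolean polynomials by: $p\ge q$ if and only if $q=0$; or $p,q\ne0$ and $\mathrm{lm}(p)>\mathrm{lm}(q)$; or $p,q\neq 0$, $\mathrm{lm}(p)=\mathrm{lm}(q)$ and $\mathrm{tail}(p)\ge\mathrm{tail}(q)$, where $\mathrm{tail}(p)$ is $p$ without its leading term. A finite set $G\subseteq I$ is a Gröbner basis of an ideal $I$ if the leading terms of the elements of $G$ generate the same ideal as the leading terms of the elements of $I$. A polynomial $h$ is reduced with respect to $G$ if no term of $h$ is divisible by the leading monomial of a nonzero element of $G$. It is a reduced normal form of $f$ with respect to $G$ if it is reduced with respect to $G$ and $f-h$ has a standard representation $f-h=\sum_{g\in G}q_g g$ with $\mathrm{lm}(q_g g)\le\mathrm{lm}(f-h)$ for all $g\in G$ with $q_g g\ne 0$. **Theorem.** Let $f\in R$ be a Boolean polynomial, let $P\subseteq\mathbb{Z}_2^n$, and let $I(P)=\{g\in R\mid g(v)=0\text{ for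 all }v\in P\}$. Then: 1. $\mathrm{zeros}(f,P)=\{v\in P\mid f(v)=0\}$. 2. $\mathrm{nfByInterpolate}(f,P)$ is a Boolean polynomial that takes the same values as $f$ on $P$, and every Boolean polynomial $q$ that takes the same values as $f$ on $P$ satisfies $q\ge\mathrm{nfByInterpolate}(f,P)$. 3. For every Gröbner basis $G$ of $I(P)$ with respect to the lexicographical ordering, $\mathrm{nfByInterpolate}(f,P)$ is a reduced normal form of $f$ with respect to $G$, and it is the only polynomial $h$ that is reduced with respect to $G$ and satisfies $f-h\in I(P)$. -/

import Mathlib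

open MvPolynomial
open scoped symmDiff

namespace BoolInterp

/-! ### Sets of subsets of the index set

A finite family of subsets of the index set `Fin n`, the object represented by a ZDD.  It encodes

* a Boolean polynomial, as the set of its terms, a term `x_{i₁} ⋯ x_{i_k}` being the set
  `{i₁, …, i_k}`; addition of Boolean polynomials is the symmetric difference `∆`;
* a set of points of `ℤ₂ⁿ`, a point `v` being the set `{i | v i ≠ 0}`.

The constants are `∅` (the polynomial `0`, the empty set of points) and `{∅}` (the polynomial `1`,
the set that contains only the origin). -/

abbrev ZDD (n : ℕ) := Finset (Finset (Fin n))

variable {n : ℕ}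

/-- The indices that occur in some member of the family. -/
def vars (S : ZDD n) : Finset (Fin n) := S.sup id

/-- The top index: the smallest index that occurs, `⊤` if the family is a constant. -/
def zddTop (S : ZDD n) : WithTop (Fin n) := (vars S).min

/-- The members that do not contain `i`. -/
def subset0 (S : ZDD n) (i : Fin n) : ZDD n := S.filter (fun s => i ∉ s)

/-- The members that contain `i`, with `i` removed from them. -/
def subset1 (S : ZDD n) (i : Fin n) : ZDD n := (S.filter (fun s => i ∈ s)).image (fun s => s.erase i)

/-- The family with then-branch `T` and else-branch `E` at index `i`. -/
def zddIte (i : Fin n) (T E : ZDD n) : ZDD n := T.image (fun s => insert i s) ∪ E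

/-- The else-branch of a non-constant family at its top index. -/
def zddElse (S : ZDD n) : ZDD n :=
  match zddTop S with
  | ⊤ => S
  | (i : Fin n) => subset0 S i

/-- The Boolean polynomial `x_i · p` (with `x_i² = x_i`). -/
def mulVar (i : Fin n) (p : ZDD n) : ZDD n :=
  ((subset0 p i).image (fun s => insert i s)) ∆ (p.filter (fun s => i ∈ s))

/-! Termination facts. -/

theorem mem_vars {S : ZDD n} {j : Fin n} : j ∈ vars S ↔ ∃ s ∈ S, j ∈ s := by
  simp [vars, Finset.mem_sup]

theorem vars_mono {S T : ZDD n} (h : S ⊆ T) : vars S ⊆ vars T := Finset.sup_mono h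

theorem zddTop_mem {S : ZDD n} {i : Fin n} (h : zddTop S = (i : WithTop (Fin n))) : i ∈ vars S :=
  Finset.mem_of_min h

theorem vars_subset0 (S : ZDD n) (i : Fin n) : vars (subset0 S i) ⊆ (vars S).erase i := by
  intro j hj
  obtain ⟨s, hs, hjs⟩ := mem_vars.1 hj
  obtain ⟨hs, his⟩ := Finset.mem_filter.1 hs
  refine Finset.mem_erase.2 ⟨?_, mem_vars.2 ⟨s, hs, hjs⟩⟩
  rintro rfl
  exact his hjs

theorem vars_subset1 (S : ZDD n) (i : Fin n) : vars (subset1 S i) ⊆ (vars S).erase i := by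
  intro j hj
  obtain ⟨s, hs, hjs⟩ := mem_vars.1 hj
  obtain ⟨t, ht, rfl⟩ := Finset.mem_image.1 hs
  obtain ⟨hne, hjt⟩ := Finset.mem_erase.1 hjs
  exact Finset.mem_erase.2 ⟨hne, mem_vars.2 ⟨t, (Finset.mem_filter.1 ht).1, hjt⟩⟩

theorem vars_zddElse (S : ZDD n) : vars (zddElse S) ⊆ vars S := by
  unfold zddElse
  split
  · exact subset_rfl
  · exact (vars_subset0 S _).trans (Finset.erase_subset _ _)

theorem card_vars_zddElse {S : ZDD n} {b : WithTop (Fin n)} (h : zddTop S < b) :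
    (vars (zddElse S)).card < (vars S).card := by
  unfold zddElse
  split
  · rename_i h'
    rw [h'] at h
    exact absurd h not_top_lt
  · rename_i i h'
    exact Finset.card_lt_card
      (lt_of_le_of_lt (vars_subset0 S i) (Finset.erase_ssubset (zddTop_mem h')))

theorem min_zddTop_mem {S T : ZDD n} {i : Fin n}
    (h : min (zddTop S) (zddTop T) = (i : WithTop (Fin n))) : i ∈ vars S ∪ vars T := by
  rcases min_choice (zddTop S) (zddTop T) with h' | h'
  · exact Finset.mem_union_left _ (zddTop_mem (h'.symm.trans h))
  · exact Finset.mem_union_right _ (zddTop_mem (h'.symm.trans h))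

theorem card_union_lt {A B V : Finset (Fin n)} {i : Fin n} (hi : i ∈ V)
    (hA : A ⊆ V.erase i) (hB : B ⊆ V.erase i) : (A ∪ B).card < V.card :=
  Finset.card_lt_card (lt_of_le_of_lt (Finset.union_subset hA hB) (Finset.erase_ssubset hi))

/-! ### Zeros of a Boolean polynomial on a set of points -/

/-- `while top(p) < b do p := else(p)`. -/
def skipTop (p : ZDD n) (b : WithTop (Fin n)) : ZDD n :=
  if zddTop p < b then skipTop (zddElse p) b else p
termination_by (vars p).card
decreasing_by exact card_vars_zddElse (by assumption)

theorem vars_skipTop (p : ZDD n) (b : WithTop (Fin n)) : vars (skipTop p b) ⊆ vars p := by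
  fun_induction skipTop p b with
  | case1 p _ ih => exact ih.trans (vars_zddElse p)
  | case2 p _ => exact subset_rfl

/-- The recursive algorithm for the zeros of the Boolean polynomial `p` among the points `S`.
The branch `⊤` is never reached, as `S` is not constant there. -/
def zeros (p S : ZDD n) : ZDD n :=
  if p = ∅ then S
  else if p = {∅} ∨ S = ∅ then ∅
  else if S = {∅} then (if ∅ ∈ p then ∅ else S)
  else
    match h : min (zddTop (skipTop p (zddTop S))) (zddTop S) with
    | ⊤ => ∅
    | (i : Fin n) =>
      let p0 := subset0 (skipTop p (zddTop S)) i
      let p1 := subset1 (skipTop p (zddTop S)) i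
      let S0 := subset0 S i
      let S1 := subset1 S i
      let Z00 := zeros p0 S0
      let Z01 := zeros p0 S1
      let Z11 := zeros p1 S1
      zddIte i (S1 \ (Z01 ∆ Z11)) Z00
termination_by (vars p ∪ vars S).card
decreasing_by
  all_goals
    have hi : i ∈ vars p ∪ vars S :=
      Finset.union_subset_union_left (vars_skipTop p _) (min_zddTop_mem h)
    have hp := Finset.erase_subset_erase i
      ((vars_skipTop p (zddTop S)).trans (Finset.subset_union_left (s₂ := vars S)))
    have hS := Finset.erase_subset_erase i (Finset.subset_union_right (s₁ := vars p) (s₂ := vars S))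
    first
    | exact card_union_lt hi ((vars_subset0 _ i).trans hp) ((vars_subset0 S i).trans hS)
    | exact card_union_lt hi ((vars_subset0 _ i).trans hp) ((vars_subset1 S i).trans hS)
    | exact card_union_lt hi ((vars_subset1 _ i).trans hp) ((vars_subset1 S i).trans hS)

/-- The points of `S` at which `p` takes the value `1`. -/
def ones (p S : ZDD n) : ZDD n := S \ zeros p S

/-! ### Lexicographically smallest interpolation

A partial Boolean function `b_Z^O` is given by the set `Z` of points where it is `0` and the
set `O` of points where it is `1`. -/

/-- The sum `b_{Z₁}^{O₁} + b_{Z₂}^{O₂}` has zero set `(Z₁ ∩ Z₂) ∪ (O₁ ∩ O₂)`. -/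
def sumZ (Z₁ O₁ Z₂ O₂ : ZDD n) : ZDD n := (Z₁ ∩ Z₂) ∪ (O₁ ∩ O₂)

/-- The sum `b_{Z₁}^{O₁} + b_{Z₂}^{O₂}` has one set `(O₁ ∆ O₂) ∩ D`, where `D` is the common
domain of definition. -/
def sumO (Z₁ O₁ Z₂ O₂ : ZDD n) : ZDD n := (O₁ ∆ O₂) ∩ ((Z₁ ∪ O₁) ∩ (Z₂ ∪ O₂))

/-- The conflict points between the subset-1 part and the subset-0 part. -/
def conflict (Z₁ O₁ Z₀ O₀ : ZDD n) : ZDD n := (Z₁ ∪ O₁) ∩ (Z₀ ∪ O₀)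

/-- The points of the subset-1 part, other than conflict points, at which the then-branch `ht` is
`1`. -/
def flipped (Z₁ O₁ Z₀ O₀ ht : ZDD n) : ZDD n := ones ht ((Z₁ ∪ O₁) \ conflict Z₁ O₁ Z₀ O₀)

/-- The zero set of the partial function prescribed for the else-branch. -/
def elseZ (Z₁ O₁ Z₀ O₀ ht : ZDD n) : ZDD n :=
  ((Z₁ \ conflict Z₁ O₁ Z₀ O₀) ∆ flipped Z₁ O₁ Z₀ O₀ ht) ∪ Z₀

/-- The one set of the partial function prescribed for the else-branch. -/
def elseO (Z₁ O₁ Z₀ O₀ ht : ZDD n) : ZDD n :=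
  ((O₁ \ conflict Z₁ O₁ Z₀ O₀) ∆ flipped Z₁ O₁ Z₀ O₀ ht) ∪ O₀

theorem vars_union_sub {A B : ZDD n} {V : Finset (Fin n)} (hA : vars A ⊆ V) (hB : vars B ⊆ V) :
    vars (A ∪ B) ⊆ V := by
  rw [vars, Finset.sup_union]
  exact Finset.union_subset hA hB

theorem vars_symmDiff_sub {A B : ZDD n} {V : Finset (Fin n)} (hA : vars A ⊆ V)
    (hB : vars B ⊆ V) : vars (A ∆ B) ⊆ V :=
  (vars_mono symmDiff_le_sup).trans (vars_union_sub hA hB)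

theorem vars_subset_then {Z O : ZDD n} {i : Fin n} :
    vars (subset1 Z i) ⊆ (vars O ∪ vars Z).erase i ∧
      vars (subset1 O i) ⊆ (vars O ∪ vars Z).erase i ∧
      vars (subset0 Z i) ⊆ (vars O ∪ vars Z).erase i ∧
      vars (subset0 O i) ⊆ (vars O ∪ vars Z).erase i :=
  have hO := Finset.erase_subset_erase i (Finset.subset_union_left (s₁ := vars O) (s₂ := vars Z))
  have hZ := Finset.erase_subset_erase i (Finset.subset_union_right (s₁ := vars O) (s₂ := vars Z))
  ⟨(vars_subset1 Z i).trans hZ, (vars_subset1 O i).trans hO, (vars_subset0 Z i).trans hZ,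
    (vars_subset0 O i).trans hO⟩

theorem card_vars_then {Z O : ZDD n} {i : Fin n} (hi : i ∈ vars O ∪ vars Z) :
    (vars (sumO (subset1 Z i) (subset1 O i) (subset0 Z i) (subset0 O i)) ∪
      vars (sumZ (subset1 Z i) (subset1 O i) (subset0 Z i) (subset0 O i))).card <
    (vars O ∪ vars Z).card := by
  obtain ⟨h1, h2, h3, h4⟩ := vars_subset_then (Z := Z) (O := O) (i := i)
  refine card_union_lt hi ?_ ?_
  · exact (vars_mono Finset.inter_subset_left).trans (vars_symmDiff_sub h2 h4)
  · exact vars_union_sub ((vars_mono Finset.inter_subset_left).trans h1)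
      ((vars_mono Finset.inter_subset_left).trans h2)

theorem card_vars_else {Z O : ZDD n} {i : Fin n} (hi : i ∈ vars O ∪ vars Z) (ht : ZDD n) :
    (vars (elseO (subset1 Z i) (subset1 O i) (subset0 Z i) (subset0 O i) ht) ∪
      vars (elseZ (subset1 Z i) (subset1 O i) (subset0 Z i) (subset0 O i) ht)).card <
    (vars O ∪ vars Z).card := by
  obtain ⟨h1, h2, h3, h4⟩ := vars_subset_then (Z := Z) (O := O) (i := i)
  have hF : vars (flipped (subset1 Z i) (subset1 O i) (subset0 Z i) (subset0 O i) ht) ⊆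
      (vars O ∪ vars Z).erase i :=
    (vars_mono (Finset.sdiff_subset.trans Finset.sdiff_subset)).trans (vars_union_sub h1 h2)
  refine card_union_lt hi ?_ ?_
  · exact vars_union_sub (vars_symmDiff_sub ((vars_mono Finset.sdiff_subset).trans h2) hF) h4
  · exact vars_union_sub (vars_symmDiff_sub ((vars_mono Finset.sdiff_subset).trans h1) hF) h3

/-- The recursive algorithm for the lexicographically smallest Boolean polynomial that
interpolates `b_Z^O`.  The branch `⊤` is never reached when `Z` and `O` are disjoint. -/
def interpolateSmallestLex (Z O : ZDD n) : ZDD n :=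
  if O = ∅ then ∅
  else if Z = ∅ then {∅}
  else
    match h : min (zddTop O) (zddTop Z) with
    | ⊤ => ∅
    | (i : Fin n) =>
      let Z1 := subset1 Z i
      let Z0 := subset0 Z i
      let O1 := subset1 O i
      let O0 := subset0 O i
      let ht := interpolateSmallestLex (sumZ Z1 O1 Z0 O0) (sumO Z1 O1 Z0 O0)
      let he := interpolateSmallestLex (elseZ Z1 O1 Z0 O0 ht) (elseO Z1 O1 Z0 O0 ht)
      (mulVar i ht) ∆ he
termination_by (vars O ∪ vars Z).card
decreasing_by
  · exact card_vars_then (min_zddTop_mem h)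
  · exact card_vars_else (min_zddTop_mem h) _

/-! ### Normal form against a variety -/

/-- A Boolean polynomial: degree at most one in each variable. -/
def IsBoolean (f : MvPolynomial (Fin n) (ZMod 2)) : Prop := ∀ i, f.degreeOf i ≤ 1

/-- The set of terms of a Boolean polynomial. -/
def encodePoly (f : MvPolynomial (Fin n) (ZMod 2)) : ZDD n := f.support.image Finsupp.support

/-- The Boolean polynomial with a given set of terms. -/
noncomputable def decodePoly (p : ZDD n) : MvPolynomial (Fin n) (ZMod 2) :=
  ∑ s ∈ p, ∏ i ∈ s, X i

/-- The encoding `v ↦ {i | v i ≠ 0}` of points. -/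
def encodePoint (v : Fin n → ZMod 2) : Finset (Fin n) := Finset.univ.filter (fun i => v i ≠ 0)

/-- The encoding of a set of points. -/
def encodePoints (P : Finset (Fin n → ZMod 2)) : ZDD n := P.image encodePoint

/-- Normal form by interpolation: compute the zeros `Z` of `f` on `P` and interpolate
`b_Z^{P ∖ Z}`. -/
noncomputable def nfByInterpolate (f : MvPolynomial (Fin n) (ZMod 2))
    (P : Finset (Fin n → ZMod 2)) : MvPolynomial (Fin n) (ZMod 2) :=
  let Z := zeros (encodePoly f) (encodePoints P)
  decodePoly (interpolateSmallestLex Z (encodePoints P \ Z))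

/-! ### Monomial orders, Gröbner bases, normal forms -/

/-- The lexicographic extension of a monomial order to Boolean polynomials; `m.subLTerm p` is the
tail of `p`. -/
inductive PolyGE (m : MonomialOrder (Fin n)) :
    MvPolynomial (Fin n) (ZMod 2) → MvPolynomial (Fin n) (ZMod 2) → Prop
  | zero (p : MvPolynomial (Fin n) (ZMod 2)) : PolyGE m p 0
  | lm (p q : MvPolynomial (Fin n) (ZMod 2)) (hp : p ≠ 0) (hq : q ≠ 0)
      (h : m.toSyn (m.degree q) < m.toSyn (m.degree p)) : PolyGE m p q
  | tail (p q : MvPolynomial (Fin n) (ZMod 2)) (hp : p ≠ 0) (hq : q ≠ 0)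
      (h : m.degree p = m.degree q) (ht : PolyGE m (m.subLTerm p) (m.subLTerm q)) : PolyGE m p q

/-- `G` is a Gröbner basis of `I`: a finite subset of `I` whose leading terms generate the leading
ideal of `I`. -/
def IsGroebnerBasis (m : MonomialOrder (Fin n)) (G : Finset (MvPolynomial (Fin n) (ZMod 2)))
    (I : Ideal (MvPolynomial (Fin n) (ZMod 2))) : Prop :=
  (∀ g ∈ G, g ∈ I) ∧
    Ideal.span (m.leadingTerm '' (G : Set (MvPolynomial (Fin n) (ZMod 2)))) =
      Ideal.span (m.leadingTerm '' (I : Set (MvPolynomial (Fin n) (ZMod 2))))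

/-- `h` is reduced with respect to `G`: no term of `h` is divisible by the leading monomial of a
nonzero element of `G`. -/
def IsReduced (m : MonomialOrder (Fin n)) (G : Finset (MvPolynomial (Fin n) (ZMod 2)))
    (h : MvPolynomial (Fin n) (ZMod 2)) : Prop :=
  ∀ t ∈ h.support, ∀ g ∈ G, g ≠ 0 → ¬ m.degree g ≤ t

/-- `u` has a standard representation `u = ∑ q_g g` with respect to `G`. -/
def HasStandardRep (m : MonomialOrder (Fin n)) (G : Finset (MvPolynomial (Fin n) (ZMod 2)))
    (u : MvPolynomial (Fin n) (ZMod 2)) : Prop :=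
  ∃ q : MvPolynomial (Fin n) (ZMod 2) → MvPolynomial (Fin n) (ZMod 2),
    u = ∑ g ∈ G, q g * g ∧ ∀ g ∈ G, m.toSyn (m.degree (q g * g)) ≤ m.toSyn (m.degree u)

/-- `h` is a reduced normal form of `f` with respect to `G`. -/
def IsReducedNormalForm (m : MonomialOrder (Fin n))
    (G : Finset (MvPolynomial (Fin n) (ZMod 2))) (f h : MvPolynomial (Fin n) (ZMod 2)) : Prop :=
  HasStandardRep m G (f - h) ∧ IsReduced m G h

end BoolInterp

open MvPolynomial
open scoped symmDiff

namespace BoolInterp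

variable {n : ℕ}

/-! ### Membership in the set operations -/

/-! Call a Boolean monomial `t` standard for a set `D` of points if no Boolean polynomial with
leading monomial `t` vanishes on `D`. The theorem reduces to two properties of the interpolant of
`b_Z^O`: it has the prescribed values, and each of its terms is standard for `Z ∪ O`.

Both follow the recursion. Let `D₁`, `D₀` be the two parts of `D = Z ∪ O` at the top index `i`. The
value of `x_i h_t + h_e` is `h_e` on the `0`-side and `h_t + h_e` on the `1`-side. So `h_t` is
forced on `D₁ ∩ D₀`, where it is the difference of the two sides, and is free elsewhere; once it is
fixed, `h_e` is prescribed on `D₁ ∪ D₀` (`Interpolates.step`). By induction the terms of `h_t` are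
standard for `D₁ ∩ D₀` and those of `h_e` for `D₁ ∪ D₀`; this lifts to `D` by `IsStandard.insert`
and `IsStandard.of_subset`.

Reduction modulo `x_i² = x_i` passes from Boolean polynomials to all of `I(P)`: no term of the
output is divisible by the leading monomial of a nonzero element of `I(P)`
(`isReducedIdeal_decodePoly`). For any monomial order, such a polynomial is the smallest in its
class modulo the ideal (`IsReducedIdeal.polyGE`), and it is the unique reduced normal form for every
Gröbner basis. -/

theorem mem_subset0 {S : ZDD n} {i : Fin n} {t : Finset (Fin n)} :
    t ∈ subset0 S i ↔ t ∈ S ∧ i ∉ t := Finset.mem_filter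

theorem mem_subset1 {S : ZDD n} {i : Fin n} {t : Finset (Fin n)} :
    t ∈ subset1 S i ↔ i ∉ t ∧ insert i t ∈ S := by
  simp only [subset1, Finset.mem_image, Finset.mem_filter]
  constructor
  · rintro ⟨s, ⟨hs, hi⟩, rfl⟩
    exact ⟨Finset.notMem_erase i s, by rwa [Finset.insert_erase hi]⟩
  · rintro ⟨hi, ht⟩
    exact ⟨_, ⟨ht, Finset.mem_insert_self i t⟩, Finset.erase_insert hi⟩

theorem erase_mem_subset1 {S : ZDD n} {i : Fin n} {t : Finset (Fin n)} (hi : i ∈ t) :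
    t.erase i ∈ subset1 S i ↔ t ∈ S := by
  simp [mem_subset1, Finset.insert_erase hi]

theorem zddIte_subset (S : ZDD n) (i : Fin n) : zddIte i (subset1 S i) (subset0 S i) = S := by
  ext t
  simp only [zddIte, Finset.mem_union, Finset.mem_image, mem_subset1, mem_subset0]
  constructor
  · rintro (⟨s, ⟨-, h⟩, rfl⟩ | h)
    exacts [h, h.1]
  · intro ht
    by_cases hi : i ∈ t
    · exact Or.inl ⟨t.erase i, by simp [Finset.insert_erase hi, ht], Finset.insert_erase hi⟩
    · exact Or.inr ⟨ht, hi⟩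

theorem mem_zddIte {T E : ZDD n} {i : Fin n} {s : Finset (Fin n)} (hT : ∀ t ∈ T, i ∉ t)
    (hE : ∀ t ∈ E, i ∉ t) : s ∈ zddIte i T E ↔ if i ∈ s then s.erase i ∈ T else s ∈ E := by
  simp only [zddIte, Finset.mem_union, Finset.mem_image]
  split_ifs with hi
  · constructor
    · rintro (⟨t, ht, rfl⟩ | h)
      · rwa [Finset.erase_insert (hT t ht)]
      · exact absurd hi (hE s h)
    · exact fun h => Or.inl ⟨_, h, Finset.insert_erase hi⟩
  · constructor
    · rintro (⟨t, ht, rfl⟩ | h)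
      · exact absurd (Finset.mem_insert_self i t) hi
      · exact h
    · exact Or.inr

theorem eq_empty_or_eq_singleton_of_zddTop_eq_top {S : ZDD n} (h : zddTop S = ⊤) :
    S = ∅ ∨ S = {∅} := by
  rw [zddTop, Finset.min_eq_top] at h
  rw [← Finset.subset_singleton_iff]
  intro s hs
  rw [Finset.mem_singleton, Finset.eq_empty_iff_forall_notMem]
  intro j hj
  have := mem_vars.2 ⟨s, hs, hj⟩
  simp [h] at this

theorem zddTop_le {S : ZDD n} {s : Finset (Fin n)} {j : Fin n} (hs : s ∈ S) (hj : j ∈ s) :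
    zddTop S ≤ j := Finset.min_le (mem_vars.2 ⟨s, hs, hj⟩)

/-! ### Values of Boolean polynomials -/

/-- The value of the Boolean polynomial `p` at the point `s`. -/
def value (p : ZDD n) (s : Finset (Fin n)) : ZMod 2 := ∑ t ∈ p, if t ⊆ s then 1 else 0

theorem value_eq_zero_or_one (p : ZDD n) (s : Finset (Fin n)) : value p s = 0 ∨ value p s = 1 := by
  generalize value p s = a
  revert a
  decide

@[simp] theorem value_empty (s : Finset (Fin n)) : value ∅ s = 0 := Finset.sum_empty

@[simp] theorem value_one (s : Finset (Fin n)) : value {∅} s = 1 := by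
  rw [value, Finset.sum_singleton, if_pos (Finset.empty_subset s)]

theorem value_origin (p : ZDD n) : value p ∅ = if ∅ ∈ p then 1 else 0 := by
  simp [value, Finset.subset_empty]

theorem value_zddIte {T E : ZDD n} {i : Fin n} (hT : ∀ t ∈ T, i ∉ t) (hE : ∀ t ∈ E, i ∉ t)
    (s : Finset (Fin n)) :
    value (zddIte i T E) s = (if i ∈ s then value T s else 0) + value E s := by
  have hd : Disjoint (T.image (fun s => insert i s)) E := by
    rw [Finset.disjoint_left]
    intro t ht hE'
    obtain ⟨r, -, rfl⟩ := Finset.mem_image.1 ht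
    exact hE _ hE' (Finset.mem_insert_self i r)
  have hinj : Set.InjOn (fun s : Finset (Fin n) => insert i s) (T : Set (Finset (Fin n))) := by
    intro a ha b hb hab
    rw [← Finset.erase_insert (hT a ha), ← Finset.erase_insert (hT b hb)]
    exact congrArg (fun r => Finset.erase r i) hab
  rw [value, zddIte, Finset.sum_union hd, Finset.sum_image hinj]
  simp only [Finset.insert_subset_iff, value]
  split_ifs with hi <;> simp [hi]

theorem value_split (p : ZDD n) (i : Fin n) (s : Finset (Fin n)) :
    value p s = (if i ∈ s then value (subset1 p i) s else 0) + value (subset0 p i) s := by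
  conv_lhs => rw [← zddIte_subset p i]
  exact value_zddIte (fun t ht => (mem_subset1.1 ht).1) (fun t ht => (mem_subset0.1 ht).2) s

theorem value_erase {p : ZDD n} {i : Fin n} (hp : ∀ t ∈ p, i ∉ t) (s : Finset (Fin n)) :
    value p (s.erase i) = value p s := by
  refine Finset.sum_congr rfl fun t ht => ?_
  simp [Finset.subset_erase, hp t ht]

theorem value_subset0_erase (p : ZDD n) (i : Fin n) (s : Finset (Fin n)) :
    value (subset0 p i) (s.erase i) = value (subset0 p i) s :=
  value_erase (fun _ ht => (mem_subset0.1 ht).2) s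

theorem value_subset1_erase (p : ZDD n) (i : Fin n) (s : Finset (Fin n)) :
    value (subset1 p i) (s.erase i) = value (subset1 p i) s :=
  value_erase (fun _ ht => (mem_subset1.1 ht).1) s

/-! ### Correctness of `zeros` -/

/-- Every discarded term contains an index below `b`, hence outside `s`, and so vanishes at `s`. -/
theorem value_skipTop (p : ZDD n) (b : WithTop (Fin n)) {s : Finset (Fin n)}
    (hs : ∀ j ∈ s, b ≤ (j : WithTop (Fin n))) : value (skipTop p b) s = value p s := by
  fun_induction skipTop p b with
  | case1 p h ih =>
    rw [ih]
    unfold zddElse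
    split
    · rfl
    · rename_i i hi
      have : i ∉ s := fun his => absurd (hs i his) (not_le.2 (lt_of_eq_of_lt hi.symm h))
      rw [value_split p i s, if_neg this, zero_add]
  | case2 p _ => rfl

theorem mem_zeros (p S : ZDD n) (s : Finset (Fin n)) :
    s ∈ zeros p S ↔ s ∈ S ∧ value p s = 0 := by
  fun_induction zeros p S generalizing s with
  | case1 S => simp
  | case2 p S _ h =>
    rcases h with rfl | rfl <;> simp
  | case3 p h1 h2 h3 =>
    simp only [Finset.notMem_empty, Finset.mem_singleton, false_iff, not_and]
    rintro rfl
    simp [value_origin, h2]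
  | case4 p h1 h2 h3 =>
    simp only [Finset.mem_singleton, iff_self_and]
    rintro rfl
    simp [value_origin, h2]
  -- A minimum equal to `⊤` makes `S` constant, and both constants were handled by earlier tests.
  | case5 p S h1 h2 h3 h =>
    have hS : zddTop S = ⊤ := top_le_iff.1 ((top_le_iff.2 h).trans (min_le_right _ _))
    rcases eq_empty_or_eq_singleton_of_zddTop_eq_top hS with hS | hS
    · exact absurd (Or.inr hS) h2
    · exact absurd hS h3
  | case6 p S h1 h2 h3 i h p0 p1 S0 S1 Z00 Z01 Z11 ih3 ih2 ih1 =>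
    rw [mem_zddIte (fun t ht => (mem_subset1.1 (Finset.mem_sdiff.1 ht).1).1)
      (fun t ht => (mem_subset0.1 ((ih3 t).1 ht).1).2)]
    have hv : s ∈ S → value p s = (if i ∈ s then value p1 s else 0) + value p0 s := fun hs => by
      rw [← value_skipTop p (zddTop S) (fun j hj => zddTop_le hs hj), value_split _ i]
    split_ifs with hi
    -- Over `ℤ₂`, `p0 + p1` vanishes exactly where both or neither of the summands do, which is the
    -- complement of `Z01 ∆ Z11`.
    · rw [Finset.mem_sdiff, Finset.mem_symmDiff, ih2, ih1, erase_mem_subset1 hi,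
        value_subset0_erase, value_subset1_erase]
      refine and_congr_right fun hs => ?_
      rw [hv hs, if_pos hi]
      rcases value_eq_zero_or_one p0 s with h0 | h0 <;>
        rcases value_eq_zero_or_one p1 s with h1 | h1 <;>
        simp [p0, p1, hs, h0, h1, CharTwo.add_self_eq_zero]
    · rw [ih3, mem_subset0]
      constructor
      · rintro ⟨⟨hs, -⟩, h0⟩
        exact ⟨hs, by rw [hv hs, if_neg hi, h0, zero_add]⟩
      · rintro ⟨hs, h0⟩
        rw [hv hs, if_neg hi, zero_add] at h0
        exact ⟨⟨hs, hi⟩, h0⟩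

theorem mem_ones (p S : ZDD n) (s : Finset (Fin n)) : s ∈ ones p S ↔ s ∈ S ∧ value p s = 1 := by
  rw [ones, Finset.mem_sdiff, mem_zeros]
  rcases value_eq_zero_or_one p s with h | h <;> simp [h]

/-! ### Correctness of `interpolateSmallestLex` -/

theorem vars_mulVar_sub {p : ZDD n} {i : Fin n} {V : Finset (Fin n)} (hp : vars p ⊆ V)
    (hi : i ∈ V) : vars (mulVar i p) ⊆ V := by
  refine vars_symmDiff_sub ?_ ((vars_mono (Finset.filter_subset _ _)).trans hp)
  intro j hj
  obtain ⟨s, hs, hjs⟩ := mem_vars.1 hj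
  obtain ⟨t, ht, rfl⟩ := Finset.mem_image.1 hs
  rcases Finset.mem_insert.1 hjs with rfl | hjt
  · exact hi
  · exact hp (mem_vars.2 ⟨t, (mem_subset0.1 ht).1, hjt⟩)

/-- Without `i` in either branch, neither `x_i² = x_i` nor cancellation plays a role, so the
recursive output is a plain branching at `i`. -/
theorem mulVar_symmDiff {i : Fin n} {T E : ZDD n} (hT : ∀ t ∈ T, i ∉ t) (hE : ∀ t ∈ E, i ∉ t) :
    mulVar i T ∆ E = zddIte i T E := by
  have h0 : subset0 T i = T := Finset.filter_true_of_mem hT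
  have h1 : T.filter (fun s => i ∈ s) = ∅ := Finset.filter_false_of_mem hT
  have hd : Disjoint (T.image (fun s => insert i s)) E := by
    rw [Finset.disjoint_left]
    intro t ht hE'
    obtain ⟨r, -, rfl⟩ := Finset.mem_image.1 ht
    exact hE _ hE' (Finset.mem_insert_self i r)
  rw [mulVar, h0, h1, ← Finset.bot_eq_empty, symmDiff_bot, hd.symmDiff_eq_sup, zddIte]
  rfl

theorem vars_then_sub {Z O : ZDD n} {i : Fin n} :
    vars (sumO (subset1 Z i) (subset1 O i) (subset0 Z i) (subset0 O i)) ∪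
      vars (sumZ (subset1 Z i) (subset1 O i) (subset0 Z i) (subset0 O i)) ⊆
    (vars O ∪ vars Z).erase i := by
  obtain ⟨h1, h2, h3, h4⟩ := vars_subset_then (Z := Z) (O := O) (i := i)
  refine Finset.union_subset ?_ ?_
  · exact (vars_mono Finset.inter_subset_left).trans (vars_symmDiff_sub h2 h4)
  · exact vars_union_sub ((vars_mono Finset.inter_subset_left).trans h1)
      ((vars_mono Finset.inter_subset_left).trans h2)

theorem vars_else_sub {Z O : ZDD n} {i : Fin n} (ht : ZDD n) :
    vars (elseO (subset1 Z i) (subset1 O i) (subset0 Z i) (subset0 O i) ht) ∪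
      vars (elseZ (subset1 Z i) (subset1 O i) (subset0 Z i) (subset0 O i) ht) ⊆
    (vars O ∪ vars Z).erase i := by
  obtain ⟨h1, h2, h3, h4⟩ := vars_subset_then (Z := Z) (O := O) (i := i)
  have hF : vars (flipped (subset1 Z i) (subset1 O i) (subset0 Z i) (subset0 O i) ht) ⊆
      (vars O ∪ vars Z).erase i :=
    (vars_mono (Finset.sdiff_subset.trans Finset.sdiff_subset)).trans (vars_union_sub h1 h2)
  refine Finset.union_subset ?_ ?_
  · exact vars_union_sub (vars_symmDiff_sub ((vars_mono Finset.sdiff_subset).trans h2) hF) h4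
  · exact vars_union_sub (vars_symmDiff_sub ((vars_mono Finset.sdiff_subset).trans h1) hF) h3

/-- Applied to the recursive calls, this shows that both branches are free of the top index `i`. -/
theorem vars_interpolateSmallestLex (Z O : ZDD n) :
    vars (interpolateSmallestLex Z O) ⊆ vars O ∪ vars Z := by
  fun_induction interpolateSmallestLex Z O with
  | case1 Z => simp [vars]
  | case2 O _ => simp [vars]
  | case3 Z O _ _ _ => simp [vars]
  | case4 =>
    rename_i Z O _ _ i h Z1 Z0 O1 O0 ht he ih2 _ ih1
    have hT : vars ht ⊆ (vars O ∪ vars Z).erase i := subset_trans ih2 vars_then_sub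
    have hE : vars he ⊆ (vars O ∪ vars Z).erase i := subset_trans ih1 (vars_else_sub ht)
    exact vars_symmDiff_sub
      (vars_mulVar_sub (hT.trans (Finset.erase_subset _ _)) (min_zddTop_mem h))
      (hE.trans (Finset.erase_subset _ _))

theorem disjoint_subset1 {Z O : ZDD n} (h : Disjoint Z O) (i : Fin n) :
    Disjoint (subset1 Z i) (subset1 O i) := by
  rw [Finset.disjoint_left] at h ⊢
  exact fun t hZ hO => h (mem_subset1.1 hZ).2 (mem_subset1.1 hO).2

theorem disjoint_subset0 {Z O : ZDD n} (h : Disjoint Z O) (i : Fin n) :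
    Disjoint (subset0 Z i) (subset0 O i) :=
  h.mono (Finset.filter_subset _ _) (Finset.filter_subset _ _)

section Step
variable {Z₁ O₁ Z₀ O₀ : ZDD n} (ht : ZDD n)

theorem disjoint_sum (h1 : Disjoint Z₁ O₁) (h0 : Disjoint Z₀ O₀) :
    Disjoint (sumZ Z₁ O₁ Z₀ O₀) (sumO Z₁ O₁ Z₀ O₀) := by
  rw [Finset.disjoint_left] at *
  intro s
  have := @h1 s
  have := @h0 s
  simp only [sumZ, sumO, Finset.mem_union, Finset.mem_inter, Finset.mem_symmDiff]
  tauto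

theorem mem_flipped {s : Finset (Fin n)} : s ∈ flipped Z₁ O₁ Z₀ O₀ ht ↔
    ((s ∈ Z₁ ∨ s ∈ O₁) ∧ ¬ (s ∈ Z₀ ∨ s ∈ O₀)) ∧ value ht s = 1 := by
  simp only [flipped, conflict, mem_ones, Finset.mem_sdiff, Finset.mem_union, Finset.mem_inter]
  tauto

theorem disjoint_else (h1 : Disjoint Z₁ O₁) (h0 : Disjoint Z₀ O₀) :
    Disjoint (elseZ Z₁ O₁ Z₀ O₀ ht) (elseO Z₁ O₁ Z₀ O₀ ht) := by
  rw [Finset.disjoint_left] at *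
  intro s
  have := @h1 s
  have := @h0 s
  simp only [elseZ, elseO, conflict, Finset.mem_union, Finset.mem_inter, Finset.mem_symmDiff,
    Finset.mem_sdiff, mem_flipped]
  tauto

theorem sumZ_union_sumO : sumZ Z₁ O₁ Z₀ O₀ ∪ sumO Z₁ O₁ Z₀ O₀ = (Z₁ ∪ O₁) ∩ (Z₀ ∪ O₀) := by
  ext s
  simp only [sumZ, sumO, Finset.mem_union, Finset.mem_inter, Finset.mem_symmDiff]
  tauto

/-- Flipping moves points between `Z₁` and `O₁`. Disjointness matters: a flipped point lying in both
would be lost. -/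
theorem elseZ_union_elseO (h1 : Disjoint Z₁ O₁) :
    elseZ Z₁ O₁ Z₀ O₀ ht ∪ elseO Z₁ O₁ Z₀ O₀ ht = (Z₁ ∪ O₁) ∪ (Z₀ ∪ O₀) := by
  rw [Finset.disjoint_left] at *
  ext s
  have := @h1 s
  simp only [elseZ, elseO, conflict, Finset.mem_union, Finset.mem_inter, Finset.mem_symmDiff,
    Finset.mem_sdiff, mem_flipped]
  tauto

end Step

/-- `h` interpolates the partial function `b_Z^O`. -/
def Interpolates (h Z O : ZDD n) : Prop :=
  (∀ s ∈ Z, value h s = 0) ∧ ∀ s ∈ O, value h s = 1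

/-- At a conflict point `he` has the value of the `0`-side and `ht` is the difference of the two
sides. At any other point of the `1`-side the value prescribed for `he` was flipped exactly where
`ht` is `1`. -/
theorem Interpolates.step {Z₁ O₁ Z₀ O₀ ht he : ZDD n} (h1 : Disjoint Z₁ O₁)
    (hht : Interpolates ht (sumZ Z₁ O₁ Z₀ O₀) (sumO Z₁ O₁ Z₀ O₀))
    (hhe : Interpolates he (elseZ Z₁ O₁ Z₀ O₀ ht) (elseO Z₁ O₁ Z₀ O₀ ht))
    {s : Finset (Fin n)} :
    (s ∈ Z₁ → value ht s + value he s = 0) ∧ (s ∈ O₁ → value ht s + value he s = 1) := by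
  have hd : s ∈ Z₁ → s ∉ O₁ := fun h => Finset.disjoint_left.1 h1 h
  have t0 := hht.1 s
  have t1 := hht.2 s
  have e0 := hhe.1 s
  have e1 := hhe.2 s
  simp only [sumZ, sumO, elseZ, elseO, conflict, Finset.mem_union, Finset.mem_inter,
    Finset.mem_symmDiff, Finset.mem_sdiff, mem_flipped] at t0 t1 e0 e1
  rcases value_eq_zero_or_one ht s with a | a <;> rcases value_eq_zero_or_one he s with b | b <;>
    by_cases hZ₀ : s ∈ Z₀ <;> by_cases hO₀ : s ∈ O₀ <;> by_cases hZ₁ : s ∈ Z₁ <;>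
    by_cases hO₁ : s ∈ O₁ <;>
    simp_all [CharTwo.add_self_eq_zero]

/-- Two nonempty constant families are both `{∅}`, hence not disjoint. -/
theorem zddTop_min_ne_top {Z O : ZDD n} (hd : Disjoint Z O) (hO : O ≠ ∅) (hZ : Z ≠ ∅) :
    min (zddTop O) (zddTop Z) ≠ ⊤ := by
  intro h
  obtain ⟨h1, h2⟩ := min_eq_top.1 h
  have hO' := (eq_empty_or_eq_singleton_of_zddTop_eq_top h1).resolve_left hO
  have hZ' := (eq_empty_or_eq_singleton_of_zddTop_eq_top h2).resolve_left hZ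
  subst hO' hZ'
  simp at hd

theorem notMem_of_vars_sub_erase {S : ZDD n} {V : Finset (Fin n)} {i : Fin n}
    (h : vars S ⊆ V.erase i) : ∀ t ∈ S, i ∉ t := fun t ht hi =>
  Finset.notMem_erase i V (h (mem_vars.2 ⟨t, ht, hi⟩))

theorem interpolates_zddIte {Z O T E : ZDD n} {i : Fin n} (hd : Disjoint Z O)
    (hT : ∀ t ∈ T, i ∉ t) (hE : ∀ t ∈ E, i ∉ t)
    (hht : Interpolates T (sumZ (subset1 Z i) (subset1 O i) (subset0 Z i) (subset0 O i))
      (sumO (subset1 Z i) (subset1 O i) (subset0 Z i) (subset0 O i)))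
    (hhe : Interpolates E (elseZ (subset1 Z i) (subset1 O i) (subset0 Z i) (subset0 O i) T)
      (elseO (subset1 Z i) (subset1 O i) (subset0 Z i) (subset0 O i) T)) :
    Interpolates (zddIte i T E) Z O := by
  have key := fun s => Interpolates.step (disjoint_subset1 hd i) hht hhe (s := s)
  constructor <;> intro s hs <;> rw [value_zddIte hT hE] <;> split_ifs with hi
  · rw [← value_erase hT, ← value_erase hE]
    exact (key _).1 ((erase_mem_subset1 hi).2 hs)
  · rw [zero_add]
    exact hhe.1 s (Finset.mem_union_right _ (mem_subset0.2 ⟨hs, hi⟩))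
  · rw [← value_erase hT, ← value_erase hE]
    exact (key _).2 ((erase_mem_subset1 hi).2 hs)
  · rw [zero_add]
    exact hhe.2 s (Finset.mem_union_right _ (mem_subset0.2 ⟨hs, hi⟩))

theorem interpolates_interpolateSmallestLex (Z O : ZDD n) (hd : Disjoint Z O) :
    Interpolates (interpolateSmallestLex Z O) Z O := by
  fun_induction interpolateSmallestLex Z O with
  | case1 Z => exact ⟨fun s _ => value_empty s, by simp⟩
  | case2 O _ => exact ⟨by simp, fun s _ => value_one s⟩
  | case3 Z O hO hZ h => exact absurd h (zddTop_min_ne_top hd hO hZ)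
  | case4 =>
    rename_i Z O _ _ i h Z1 Z0 O1 O0 ht he ih2 _ ih1
    have hT : vars ht ⊆ (vars O ∪ vars Z).erase i :=
      subset_trans (vars_interpolateSmallestLex _ _) vars_then_sub
    have hE : vars he ⊆ (vars O ∪ vars Z).erase i :=
      subset_trans (vars_interpolateSmallestLex _ _) (vars_else_sub ht)
    have hT' := notMem_of_vars_sub_erase hT
    have hE' := notMem_of_vars_sub_erase hE
    rw [mulVar_symmDiff hT' hE']
    exact interpolates_zddIte hd hT' hE'
      (ih2 (disjoint_sum (disjoint_subset1 hd i) (disjoint_subset0 hd i)))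
      (ih1 (disjoint_else ht (disjoint_subset1 hd i) (disjoint_subset0 hd i)))

/-! ### Terms of the interpolant are standard monomials -/

/-- The lexicographic order on Boolean monomials. -/
def LexLT (s t : Finset (Fin n)) : Prop :=
  ∃ j ∈ t, j ∉ s ∧ ∀ k < j, k ∈ s ↔ k ∈ t

/-- `t` is the leading monomial of no Boolean polynomial that vanishes on `D`. -/
def IsStandard (D : ZDD n) (t : Finset (Fin n)) : Prop :=
  ∀ u : ZDD n, t ∈ u → (∀ s ∈ u, s = t ∨ LexLT s t) → ∃ d ∈ D, value u d ≠ 0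

/-- If `u` has leading monomial `x_i t`, then `u₁ = subset1 u i` has leading monomial `t`. Moreover
`u₁(d) = u(d ∪ {i}) - u(d)`, so vanishing of `u` on `D` gives vanishing of `u₁` where both points
lie in `D`. -/
theorem IsStandard.insert {D : ZDD n} {t : Finset (Fin n)} {i : Fin n} (hi : i ∉ t)
    (h : IsStandard (subset1 D i ∩ subset0 D i) t) : IsStandard D (insert i t) := by
  intro u htu hu
  obtain ⟨d, hd, hv⟩ := h (subset1 u i) (mem_subset1.2 ⟨hi, htu⟩) (fun s hs => by
    obtain ⟨his, hs⟩ := mem_subset1.1 hs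
    rcases hu _ hs with h | ⟨j, hj, hjs, hk⟩
    · left
      rw [← Finset.erase_insert his, h, Finset.erase_insert hi]
    · right
      have hji : j ≠ i := fun h => hjs (h ▸ Finset.mem_insert_self i s)
      refine ⟨j, (Finset.mem_insert.1 hj).resolve_left hji,
        fun h => hjs (Finset.mem_insert_of_mem h), fun k hkj => ?_⟩
      by_cases hki : k = i
      · subst hki
        simp [hi, his]
      · simpa [hki] using hk k hkj)
  obtain ⟨hd1, hd0⟩ := Finset.mem_inter.1 hd
  obtain ⟨hid, hd1⟩ := mem_subset1.1 hd1
  obtain ⟨hd0, -⟩ := mem_subset0.1 hd0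
  by_contra! hc
  have e1 := hc _ hd1
  have e0 := hc _ hd0
  rw [value_split u i] at e0 e1
  rw [if_neg hid, zero_add] at e0
  rw [if_pos (Finset.mem_insert_self i d), ← value_subset0_erase, ← value_subset1_erase,
    Finset.erase_insert hid, e0, add_zero] at e1
  exact hv e1

/-- A term containing `i` would be lexicographically larger than `t`, so a `u` with leading monomial
`t` does not involve `x_i`, and its values on `D` are its values on the projection of `D`. -/
theorem IsStandard.of_subset {D : ZDD n} {t : Finset (Fin n)} {i : Fin n}
    (hi : ∀ j ∈ t, i < j) (h : IsStandard (subset1 D i ∪ subset0 D i) t) : IsStandard D t := by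
  intro u htu hu
  have hu' : ∀ s ∈ u, i ∉ s := fun s hs his => by
    rcases hu s hs with rfl | ⟨j, hj, hjs, hk⟩
    · exact lt_irrefl i (hi i his)
    · exact lt_irrefl i (hi i ((hk i (hi j hj)).1 his))
  obtain ⟨d, hd, hv⟩ := h u htu hu
  rcases Finset.mem_union.1 hd with hd | hd
  · obtain ⟨hid, hd⟩ := mem_subset1.1 hd
    refine ⟨_, hd, ?_⟩
    rwa [← value_erase hu', Finset.erase_insert hid]
  · exact ⟨d, (mem_subset0.1 hd).1, hv⟩

theorem isStandard_empty {D : ZDD n} (hD : D ≠ ∅) : IsStandard D ∅ := by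
  intro u h0 hu
  obtain ⟨d, hd⟩ := Finset.nonempty_iff_ne_empty.2 hD
  have : u = {∅} := by
    refine Finset.eq_singleton_iff_unique_mem.2 ⟨h0, fun s hs => ?_⟩
    rcases hu s hs with h | ⟨j, hj, -⟩
    · exact h
    · simp at hj
  exact ⟨d, hd, by simp [this]⟩

theorem subset0_union (Z O : ZDD n) (i : Fin n) :
    subset0 Z i ∪ subset0 O i = subset0 (Z ∪ O) i := (Finset.filter_union _ _ _).symm

theorem subset1_union (Z O : ZDD n) (i : Fin n) :
    subset1 Z i ∪ subset1 O i = subset1 (Z ∪ O) i := by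
  simp [subset1, Finset.filter_union, Finset.image_union]

theorem isStandard_of_mem_interpolateSmallestLex (Z O : ZDD n) (hd : Disjoint Z O)
    {t : Finset (Fin n)} (ht : t ∈ interpolateSmallestLex Z O) : IsStandard (Z ∪ O) t := by
  fun_induction interpolateSmallestLex Z O generalizing t with
  | case1 Z => simp at ht
  | case2 O hO =>
    rw [Finset.mem_singleton] at ht
    subst ht
    exact isStandard_empty (by simpa using hO)
  | case3 Z O _ _ _ => simp at ht
  | case4 =>
    rename_i Z O _ _ i h Z1 Z0 O1 O0 T E ih2 _ ih1
    have hT : vars T ⊆ (vars O ∪ vars Z).erase i :=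
      subset_trans (vars_interpolateSmallestLex _ _) vars_then_sub
    have hE : vars E ⊆ (vars O ∪ vars Z).erase i :=
      subset_trans (vars_interpolateSmallestLex _ _) (vars_else_sub T)
    have hT' := notMem_of_vars_sub_erase hT
    have hE' := notMem_of_vars_sub_erase hE
    have hd1 := disjoint_subset1 hd i
    have hd0 := disjoint_subset0 hd i
    rw [mulVar_symmDiff hT' hE', mem_zddIte hT' hE'] at ht
    split_ifs at ht with hi
    · have := ih2 (disjoint_sum hd1 hd0) ht
      rw [sumZ_union_sumO, subset1_union, subset0_union] at this
      simpa [Finset.insert_erase hi] using this.insert (Finset.notMem_erase i t)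
    · have := ih1 (disjoint_else T hd1 hd0) ht
      rw [elseZ_union_elseO T hd1, subset1_union, subset0_union] at this
      -- The index `i` is the least one occurring in `Z` and `O`, and the else-branch uses only the
      -- others.
      refine this.of_subset fun j hj => ?_
      have hjV := hE (mem_vars.2 ⟨t, ht, hj⟩)
      obtain ⟨hji, hjV⟩ := Finset.mem_erase.1 hjV
      refine lt_of_le_of_ne ?_ (Ne.symm hji)
      rw [← WithTop.coe_le_coe, ← WithTop.some_eq_coe i, ← h]
      rcases Finset.mem_union.1 hjV with hj | hj
      · exact (min_le_left _ _).trans (Finset.min_le hj)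
      · exact (min_le_right _ _).trans (Finset.min_le hj)

/-! ### Boolean polynomials and their sets of terms -/

/-- The exponent vector of a Boolean monomial. -/
noncomputable def expVec (s : Finset (Fin n)) : Fin n →₀ ℕ := Finsupp.indicator s fun _ _ => 1

theorem expVec_apply (s : Finset (Fin n)) (i : Fin n) : expVec s i = if i ∈ s then 1 else 0 := by
  simp [expVec, Finsupp.indicator_apply]

@[simp] theorem support_expVec (s : Finset (Fin n)) : (expVec s).support = s := by
  ext i
  simp [expVec_apply]

theorem expVec_injective : Function.Injective (expVec (n := n)) := fun s t h => by
  rw [← support_expVec s, h, support_expVec]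

theorem expVec_support_le (d : Fin n →₀ ℕ) : expVec d.support ≤ d := fun i => by
  rw [expVec_apply]
  split_ifs with h
  · exact Nat.one_le_iff_ne_zero.2 (Finsupp.mem_support_iff.1 h)
  · exact Nat.zero_le _

theorem eq_expVec_support {d : Fin n →₀ ℕ} (h : ∀ i, d i ≤ 1) : d = expVec d.support := by
  refine le_antisymm (fun i => ?_) (expVec_support_le d)
  rw [expVec_apply]
  split_ifs with hi
  · exact h i
  · simpa using hi

theorem expVec_lt_iff {s t : Finset (Fin n)} :
    MonomialOrder.lex.toSyn (expVec s) < MonomialOrder.lex.toSyn (expVec t) ↔ LexLT s t := by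
  have key : ∀ k, expVec s k = expVec t k ↔ (k ∈ s ↔ k ∈ t) := fun k => by
    rw [expVec_apply, expVec_apply]
    by_cases hs : k ∈ s <;> by_cases ht : k ∈ t <;> simp [hs, ht]
  have key' : ∀ k, expVec s k < expVec t k ↔ k ∈ t ∧ k ∉ s := fun k => by
    rw [expVec_apply, expVec_apply]
    by_cases hs : k ∈ s <;> by_cases ht : k ∈ t <;> simp [hs, ht]
  refine exists_congr fun j => ?_
  change (∀ k, k < j → expVec s k = expVec t k) ∧ expVec s j < expVec t j ↔ _
  rw [key']
  simp only [key]
  tauto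

theorem expVec_le {s t : Finset (Fin n)}
    (h : MonomialOrder.lex.toSyn (expVec s) ≤ MonomialOrder.lex.toSyn (expVec t)) :
    s = t ∨ LexLT s t := by
  rcases h.eq_or_lt with h | h
  · exact Or.inl (expVec_injective (MonomialOrder.lex.toSyn.injective h))
  · exact Or.inr (expVec_lt_iff.1 h)

theorem prod_X_eq_monomial (s : Finset (Fin n)) :
    ∏ i ∈ s, (X i : MvPolynomial (Fin n) (ZMod 2)) = monomial (expVec s) 1 := by
  rw [monomial_eq, C_1, one_mul, Finsupp.prod, support_expVec]
  exact Finset.prod_congr rfl fun i hi => by rw [expVec_apply, if_pos hi, pow_one]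

theorem support_decodePoly (p : ZDD n) : (decodePoly p).support = p.image expVec := by
  ext d
  simp only [decodePoly, prod_X_eq_monomial, mem_support_iff, coeff_sum, coeff_monomial,
    Finset.mem_image]
  constructor
  · intro h
    obtain ⟨s, hs, h⟩ := Finset.exists_ne_zero_of_sum_ne_zero h
    exact ⟨s, hs, by by_contra hc; simp [hc] at h⟩
  · rintro ⟨s, hs, rfl⟩
    simp [expVec_injective.eq_iff, hs]

theorem isBoolean_decodePoly (p : ZDD n) : IsBoolean (decodePoly p) := by
  intro i
  rw [degreeOf_le_iff]
  intro d hd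
  rw [support_decodePoly, Finset.mem_image] at hd
  obtain ⟨s, -, rfl⟩ := hd
  rw [expVec_apply]
  split_ifs <;> simp

theorem coeff_eq_one {f : MvPolynomial (Fin n) (ZMod 2)} {d : Fin n →₀ ℕ} (h : d ∈ f.support) :
    coeff d f = 1 := by
  rw [mem_support_iff] at h
  generalize coeff d f = a at h
  revert a
  decide

theorem IsBoolean.eq_expVec {f : MvPolynomial (Fin n) (ZMod 2)} (hf : IsBoolean f)
    {d : Fin n →₀ ℕ} (hd : d ∈ f.support) : d = expVec d.support :=
  eq_expVec_support fun i => (degreeOf_le_iff.1 (hf i)) d hd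

theorem decodePoly_encodePoly {f : MvPolynomial (Fin n) (ZMod 2)} (hf : IsBoolean f) :
    decodePoly (encodePoly f) = f := by
  rw [decodePoly, encodePoly, Finset.sum_image]
  · conv_rhs => rw [f.as_sum]
    refine Finset.sum_congr rfl fun d hd => ?_
    rw [prod_X_eq_monomial, ← hf.eq_expVec hd, coeff_eq_one hd]
  · intro a ha b hb hab
    rw [hf.eq_expVec ha, hf.eq_expVec hb]
    exact congrArg expVec hab

/-! ### Evaluation, and reduction modulo the field equations -/

theorem prod_pow_eq_ite (v : Fin n → ZMod 2) (d : Fin n →₀ ℕ) :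
    (d.prod fun i k => v i ^ k) = if d.support ⊆ encodePoint v then 1 else 0 := by
  split_ifs with h
  · refine Finset.prod_eq_one fun i hi => ?_
    have hi' := h hi
    simp only [encodePoint, Finset.mem_filter, Finset.mem_univ, true_and] at hi'
    have : v i = 1 := by
      generalize v i = a at hi'
      revert a
      decide
    simp [this]
  · obtain ⟨i, hi, hv⟩ := Finset.not_subset.1 h
    refine Finset.prod_eq_zero hi ?_
    have : v i = 0 := by simpa [encodePoint] using hv
    simpa [this] using hi

theorem eval_eq_sum_ite (v : Fin n → ZMod 2) (f : MvPolynomial (Fin n) (ZMod 2)) :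
    eval v f = ∑ d ∈ f.support, if d.support ⊆ encodePoint v then coeff d f else 0 := by
  rw [eval_eq]
  refine Finset.sum_congr rfl fun d _ => ?_
  have := prod_pow_eq_ite v d
  rw [Finsupp.prod] at this
  rw [this, mul_ite, mul_one, mul_zero]

theorem eval_decodePoly (v : Fin n → ZMod 2) (p : ZDD n) :
    eval v (decodePoly p) = value p (encodePoint v) := by
  rw [decodePoly, map_sum]
  refine Finset.sum_congr rfl fun s _ => ?_
  rw [prod_X_eq_monomial, eval_monomial, one_mul, prod_pow_eq_ite, support_expVec]

/-- The remainder of `f` modulo the field equations `x_i² = x_i`, as a set of terms. -/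
noncomputable def boolPart (f : MvPolynomial (Fin n) (ZMod 2)) : ZDD n :=
  Finset.univ.filter fun s => ∑ d ∈ f.support with d.support = s, coeff d f ≠ 0

/-- At a point of `ℤ₂ⁿ` a monomial depends only on its support, so the terms can be grouped by
support. -/
theorem value_boolPart (f : MvPolynomial (Fin n) (ZMod 2)) (v : Fin n → ZMod 2) :
    value (boolPart f) (encodePoint v) = eval v f := by
  have h01 : ∀ a : ZMod 2, (if a ≠ 0 then 1 else 0) = a := by decide
  have : value (boolPart f) (encodePoint v) = ∑ s : Finset (Fin n),
      ∑ d ∈ f.support with d.support = s,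
        if d.support ⊆ encodePoint v then coeff d f else 0 := by
    rw [value, boolPart, Finset.sum_filter]
    refine Finset.sum_congr rfl fun s _ => ?_
    by_cases hs : s ⊆ encodePoint v
    · simp only [hs, if_true]
      rw [h01]
      exact Finset.sum_congr rfl fun d hd => by
        rw [(Finset.mem_filter.1 hd).2, if_pos hs]
    · simp only [hs, if_false, ite_self]
      exact (Finset.sum_eq_zero fun d hd => by
        rw [(Finset.mem_filter.1 hd).2, if_neg hs]).symm
  rw [this, eval_eq_sum_ite, Finset.sum_fiberwise]

/-- Replacing an exponent by its squarefree part never increases it. Hence no term rises above the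
leading one, and a term that collapsed onto `t` would be at least `t`, so it is the leading term
itself and nothing cancels it. -/
theorem lex_boolPart {f : MvPolynomial (Fin n) (ZMod 2)} {t : Finset (Fin n)} (hf : f ≠ 0)
    (ht : MonomialOrder.lex.degree f = expVec t) :
    t ∈ boolPart f ∧ ∀ s ∈ boolPart f, s = t ∨ LexLT s t := by
  have hle : ∀ d ∈ f.support, MonomialOrder.lex.toSyn (expVec d.support) ≤
      MonomialOrder.lex.toSyn (expVec t) := fun d hd => by
    rw [← ht]
    exact (MonomialOrder.lex.toSyn_monotone (expVec_support_le d)).trans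
      (MonomialOrder.lex.le_degree hd)
  have htf : expVec t ∈ f.support := ht ▸ MonomialOrder.lex.degree_mem_support hf
  constructor
  · have : f.support.filter (fun d => d.support = t) = {expVec t} := by
      refine Finset.eq_singleton_iff_unique_mem.2 ⟨by simp [htf], fun d hd => ?_⟩
      obtain ⟨hdf, rfl⟩ := Finset.mem_filter.1 hd
      refine MonomialOrder.lex.toSyn.injective (le_antisymm ?_ ?_)
      · rw [← ht]
        exact MonomialOrder.lex.le_degree hdf
      · exact MonomialOrder.lex.toSyn_monotone (expVec_support_le d)
    rw [boolPart, Finset.mem_filter, this, Finset.sum_singleton]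
    exact ⟨Finset.mem_univ _, mem_support_iff.1 htf⟩
  · intro s hs
    obtain ⟨d, hd, -⟩ := Finset.exists_ne_zero_of_sum_ne_zero (Finset.mem_filter.1 hs).2
    obtain ⟨hdf, rfl⟩ := Finset.mem_filter.1 hd
    exact expVec_le (hle d hdf)

theorem encodePoint_injective : Function.Injective (encodePoint (n := n)) := by
  intro v w h
  funext i
  have hi : v i ≠ 0 ↔ w i ≠ 0 := by
    have := Finset.ext_iff.1 h i
    simpa [encodePoint] using this
  generalize v i = a at hi
  generalize w i = b at hi
  revert a b
  decide

/-! ### Normal forms -/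

section Generic
variable (m : MonomialOrder (Fin n))

/-- No term of `h` is divisible by the leading monomial of a nonzero element of `I`. -/
def IsReducedIdeal (I : Ideal (MvPolynomial (Fin n) (ZMod 2)))
    (h : MvPolynomial (Fin n) (ZMod 2)) : Prop :=
  ∀ t ∈ h.support, ∀ g ∈ I, g ≠ 0 → ¬ m.degree g ≤ t

variable {m}

/-- This hypothesis survives the recursion: removing a common leading term leaves `q - h` unchanged
and shrinks the support of `h`. If `h` had the larger leading monomial, that monomial would be the
degree of `q - h`. -/
theorem polyGE_of_degree_sub_notMem (q h : MvPolynomial (Fin n) (ZMod 2))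
    (H : q = h ∨ m.degree (q - h) ∉ h.support) : PolyGE m q h := by
  induction hk : h.support.card using Nat.strong_induction_on generalizing q h with
  | _ k ih =>
  subst hk
  by_cases h0 : h = 0
  · subst h0
    exact PolyGE.zero q
  have q0 : q ≠ 0 := by
    rintro rfl
    rcases H with H | H
    · exact h0 H.symm
    · rw [zero_sub, m.degree_neg] at H
      exact H (m.degree_mem_support h0)
  rcases lt_trichotomy (m.toSyn (m.degree h)) (m.toSyn (m.degree q)) with hlt | heq | hgt
  · exact PolyGE.lm q h q0 h0 hlt
  · have hdeg : m.degree q = m.degree h := m.toSyn.injective heq.symm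
    refine PolyGE.tail q h q0 h0 hdeg ?_
    have hq : m.subLTerm q = q - monomial (m.degree h) 1 := by
      rw [MonomialOrder.subLTerm, MonomialOrder.leadingCoeff,
        coeff_eq_one (m.degree_mem_support q0), hdeg]
    have hh : m.subLTerm h = h - monomial (m.degree h) 1 := by
      rw [MonomialOrder.subLTerm, MonomialOrder.leadingCoeff,
        coeff_eq_one (m.degree_mem_support h0)]
    have hs : (m.subLTerm h).support ⊂ h.support := by
      rw [Finset.ssubset_iff_of_subset]
      · refine ⟨m.degree h, m.degree_mem_support h0, ?_⟩
        rw [hh, mem_support_iff, coeff_sub, coeff_eq_one (m.degree_mem_support h0)]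
        simp
      · intro d hd
        rw [hh, mem_support_iff, coeff_sub, coeff_monomial] at hd
        split_ifs at hd with hdd
        · exact hdd ▸ m.degree_mem_support h0
        · simpa using hd
    refine ih _ (Finset.card_lt_card hs) _ _ ?_ rfl
    rcases H with rfl | H
    · exact Or.inl rfl
    · refine Or.inr fun hmem => H (hs.1 ?_)
      rwa [hq, hh, sub_sub_sub_cancel_right, ← hh] at hmem
  · rcases H with rfl | H
    · exact absurd hgt (lt_irrefl _)
    · refine absurd (m.degree_mem_support h0) ?_
      rwa [← neg_sub, m.degree_neg, m.degree_sub_of_lt hgt] at H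

theorem IsReducedIdeal.polyGE {I : Ideal (MvPolynomial (Fin n) (ZMod 2))}
    {q h : MvPolynomial (Fin n) (ZMod 2)} (hh : IsReducedIdeal m I h) (hq : q - h ∈ I) :
    PolyGE m q h := by
  refine polyGE_of_degree_sub_notMem q h ?_
  by_cases hqh : q = h
  · exact Or.inl hqh
  · exact Or.inr fun hmem => hh _ hmem _ hq (sub_ne_zero.2 hqh) le_rfl

variable {I : Ideal (MvPolynomial (Fin n) (ZMod 2))}
  {G : Finset (MvPolynomial (Fin n) (ZMod 2))}

theorem leadingTerm_eq_monomial {g : MvPolynomial (Fin n) (ZMod 2)} (hg : g ≠ 0) :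
    m.leadingTerm g = monomial (m.degree g) 1 := by
  rw [MonomialOrder.leadingTerm, MonomialOrder.leadingCoeff,
    coeff_eq_one (m.degree_mem_support hg)]

theorem IsGroebnerBasis.exists_degree_le (hG : IsGroebnerBasis m G I)
    {u : MvPolynomial (Fin n) (ZMod 2)} (hu : u ∈ I) (h0 : u ≠ 0) :
    ∃ g ∈ G, g ≠ 0 ∧ m.degree g ≤ m.degree u := by
  have hmem : m.leadingTerm u ∈ Ideal.span
      (m.leadingTerm '' (G : Set (MvPolynomial (Fin n) (ZMod 2)))) := by
    rw [hG.2]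
    exact Ideal.subset_span ⟨u, hu, rfl⟩
  have himg : m.leadingTerm '' ((G : Set (MvPolynomial (Fin n) (ZMod 2))) \ {0}) =
      (fun s => monomial s (1 : ZMod 2)) ''
        (m.degree '' ((G : Set (MvPolynomial (Fin n) (ZMod 2))) \ {0})) := by
    rw [Set.image_image]
    exact Set.image_congr fun g hg => leadingTerm_eq_monomial hg.2
  -- Once zero is dropped from `G`, its leading terms are monomials with coefficient `1`, so ideal
  -- membership becomes divisibility.
  rw [← Ideal.span_sdiff_singleton_zero, ← m.image_leadingTerm_sdiff_singleton_zero, himg,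
    mem_ideal_span_monomial_image] at hmem
  obtain ⟨_, ⟨g, hg, rfl⟩, hle⟩ := hmem (m.degree u) (by
    rw [leadingTerm_eq_monomial h0, mem_support_iff, coeff_monomial, if_pos rfl]
    exact one_ne_zero)
  exact ⟨g, hg.1, hg.2, hle⟩

theorem IsGroebnerBasis.eq_zero (hG : IsGroebnerBasis m G I)
    {u : MvPolynomial (Fin n) (ZMod 2)} (hu : u ∈ I)
    (hr : ∀ t ∈ u.support, ∀ g ∈ G, g ≠ 0 → ¬ m.degree g ≤ t) :
    u = 0 := by
  by_contra h0
  obtain ⟨g, hg, hg0, hle⟩ := hG.exists_degree_le hu h0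
  exact hr _ (m.degree_mem_support h0) g hg hg0 hle

/-- The division algorithm gives the degree bounds. Its remainder lies in `I` and has no term
divisible by a leading monomial of `G`, so it is zero. -/
theorem IsGroebnerBasis.hasStandardRep (hG : IsGroebnerBasis m G I)
    {u : MvPolynomial (Fin n) (ZMod 2)} (hu : u ∈ I) : HasStandardRep m G u := by
  classical
  obtain ⟨q, r, hqr, hdeg, hr⟩ := m.div_set (B := ↑(G.erase 0))
    (fun b hb => IsUnit.mk0 _ (m.leadingCoeff_ne_zero_iff.2 (Finset.ne_of_mem_erase hb))) u
  -- Division needs invertible leading coefficients, so it runs over `G.erase 0`; the quotients are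
  -- extended by zero.
  let Q : MvPolynomial (Fin n) (ZMod 2) → MvPolynomial (Fin n) (ZMod 2) := fun g =>
    if hg : g ∈ G.erase 0 then q ⟨g, hg⟩ else 0
  have hQ : ∀ b : (G.erase 0 : Finset _), q b = Q b := fun b => by
    simp only [Q]
    rw [dif_pos b.2]
    rfl
  have hsum : Finsupp.linearCombination (MvPolynomial (Fin n) (ZMod 2))
      (fun b : (G.erase 0 : Finset _) => (b : MvPolynomial (Fin n) (ZMod 2))) q =
        ∑ g ∈ G, Q g * g := by
    rw [← Finset.sum_erase (f := fun g => Q g * g) G (mul_zero (Q 0)), ← Finset.sum_coe_sort,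
      Finsupp.linearCombination_apply]
    refine (Finsupp.sum_fintype q (fun b a => a • (b : MvPolynomial (Fin n) (ZMod 2)))
      fun b => zero_smul _ _).trans ?_
    exact Finset.sum_congr rfl fun b _ => by rw [smul_eq_mul, ← hQ b]
  replace hqr : u = ∑ g ∈ G, Q g * g + r := hqr.trans (congrArg (· + r) hsum)
  have hr0 : r = 0 := by
    refine hG.eq_zero ?_ fun t ht g hg hg0 => hr t ht g (Finset.mem_erase.2 ⟨hg0, hg⟩)
    rw [← sub_eq_iff_eq_add'.2 hqr]
    exact I.sub_mem hu (I.sum_mem fun g hg => I.mul_mem_left _ (hG.1 g hg))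
  refine ⟨Q, by rw [hqr, hr0, add_zero], fun g hg => ?_⟩
  by_cases hg' : g ∈ G.erase 0
  · rw [← hQ ⟨g, hg'⟩, mul_comm]
    exact hdeg ⟨g, hg'⟩
  · have : Q g = 0 := dif_neg hg'
    rw [this, zero_mul, m.degree_zero, map_zero]
    exact bot_le

theorem IsReducedIdeal.isReducedNormalForm {f h : MvPolynomial (Fin n) (ZMod 2)}
    (hG : IsGroebnerBasis m G I) (hh : IsReducedIdeal m I h) (hf : f - h ∈ I) :
    IsReducedNormalForm m G f h :=
  ⟨hG.hasStandardRep hf, fun t ht g hg => hh t ht g (hG.1 g hg)⟩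

theorem IsReducedIdeal.eq_of_isReduced {f h k : MvPolynomial (Fin n) (ZMod 2)}
    (hG : IsGroebnerBasis m G I) (hh : IsReducedIdeal m I h) (hf : f - h ∈ I)
    (hk : IsReduced m G k) (hfk : f - k ∈ I) : k = h := by
  classical
  rw [← sub_eq_zero]
  refine hG.eq_zero ?_ fun t ht g hg hg0 => ?_
  · simpa using I.sub_mem hf hfk
  · rcases Finset.mem_union.1 (support_sub _ _ _ ht) with ht | ht
    · exact hk t ht g hg hg0
    · exact hh t ht g (hG.1 g hg) hg0

end Generic

/-! ### Interpolants and the vanishing ideal -/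

theorem isReducedIdeal_decodePoly {p : ZDD n} {P : Finset (Fin n → ZMod 2)}
    (hp : ∀ t ∈ p, IsStandard (encodePoints P) t) :
    IsReducedIdeal MonomialOrder.lex
      (vanishingIdeal (ZMod 2) (P : Set (Fin n → ZMod 2))) (decodePoly p) := by
  intro t ht g hg hg0 hle
  rw [support_decodePoly, Finset.mem_image] at ht
  obtain ⟨s, hs, rfl⟩ := ht
  -- This multiplier raises the leading monomial of `g` to exactly `s`; the Boolean part of the
  -- product then contradicts the standardness of `s`.
  have hm0 : monomial (expVec s - MonomialOrder.lex.degree g) (1 : ZMod 2) ≠ 0 := by simp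
  have hdeg : MonomialOrder.lex.degree
      (monomial (expVec s - MonomialOrder.lex.degree g) (1 : ZMod 2) * g) = expVec s := by
    rw [MonomialOrder.lex.degree_mul hm0 hg0, MonomialOrder.lex.degree_monomial,
      if_neg one_ne_zero, tsub_add_cancel_of_le hle]
  obtain ⟨hsu, hu⟩ := lex_boolPart (mul_ne_zero hm0 hg0) hdeg
  obtain ⟨d, hd, hv⟩ := hp s hs _ hsu hu
  obtain ⟨v, hvP, rfl⟩ := Finset.mem_image.1 hd
  rw [value_boolPart, map_mul] at hv
  have := mem_vanishingIdeal_iff.1 hg v hvP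
  rw [aeval_eq_eval] at this
  exact hv (mul_eq_zero_of_right _ this)

theorem mem_encodePoints {P : Finset (Fin n → ZMod 2)} {v : Fin n → ZMod 2} :
    encodePoint v ∈ encodePoints P ↔ v ∈ P := by
  simp [encodePoints, encodePoint_injective.eq_iff]

theorem zeros_encodePoly {f : MvPolynomial (Fin n) (ZMod 2)} (hf : IsBoolean f)
    (P : Finset (Fin n → ZMod 2)) :
    zeros (encodePoly f) (encodePoints P) =
      encodePoints (P.filter fun v => eval v f = 0) := by
  ext s
  simp only [mem_zeros, encodePoints, Finset.mem_image, Finset.mem_filter]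
  constructor
  · rintro ⟨⟨v, hv, rfl⟩, h⟩
    rw [← eval_decodePoly, decodePoly_encodePoly hf] at h
    exact ⟨v, ⟨hv, h⟩, rfl⟩
  · rintro ⟨v, ⟨hv, h⟩, rfl⟩
    refine ⟨⟨v, hv, rfl⟩, ?_⟩
    rwa [← eval_decodePoly, decodePoly_encodePoly hf]

theorem eval_nfByInterpolate {f : MvPolynomial (Fin n) (ZMod 2)} (hf : IsBoolean f)
    {P : Finset (Fin n → ZMod 2)} {v : Fin n → ZMod 2} (hv : v ∈ P) :
    eval v (nfByInterpolate f P) = eval v f := by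
  -- Here `ones` unfolds to the set difference used in `nfByInterpolate`.
  have h := interpolates_interpolateSmallestLex (zeros (encodePoly f) (encodePoints P))
    (ones (encodePoly f) (encodePoints P)) disjoint_sdiff_self_right
  have hd := congrArg (eval v) (decodePoly_encodePoly hf)
  rw [eval_decodePoly] at hd
  rw [nfByInterpolate, eval_decodePoly, ← hd]
  have hvP := mem_encodePoints.2 hv
  rcases value_eq_zero_or_one (encodePoly f) (encodePoint v) with h0 | h1
  · rw [h0]
    exact h.1 _ ((mem_zeros _ _ _).2 ⟨hvP, h0⟩)
  · rw [h1]
    exact h.2 _ ((mem_ones _ _ _).2 ⟨hvP, h1⟩)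

theorem isReducedIdeal_nfByInterpolate (f : MvPolynomial (Fin n) (ZMod 2))
    (P : Finset (Fin n → ZMod 2)) :
    IsReducedIdeal MonomialOrder.lex (vanishingIdeal (ZMod 2) (P : Set (Fin n → ZMod 2)))
      (nfByInterpolate f P) := by
  refine isReducedIdeal_decodePoly fun t ht => ?_
  have := isStandard_of_mem_interpolateSmallestLex _ _ disjoint_sdiff_self_right ht
  rwa [Finset.union_sdiff_of_subset fun s hs => ((mem_zeros _ _ _).1 hs).1] at this

theorem sub_mem_vanishingIdeal {f g : MvPolynomial (Fin n) (ZMod 2)}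
    {P : Finset (Fin n → ZMod 2)} (h : ∀ v ∈ P, eval v f = eval v g) :
    f - g ∈ vanishingIdeal (ZMod 2) (P : Set (Fin n → ZMod 2)) := by
  rw [mem_vanishingIdeal_iff]
  intro v hv
  rw [aeval_eq_eval, map_sub, h v hv, sub_self]

end BoolInterp

theorem mainTheorem2 (n : ℕ) (f : MvPolynomial (Fin n) (ZMod 2)) (hf : BoolInterp.IsBoolean f)
    (P : Finset (Fin n → ZMod 2)) :
    -- the first step computes the zeros of `f` on `P`
    BoolInterp.zeros (BoolInterp.encodePoly f) (BoolInterp.encodePoints P) =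
        BoolInterp.encodePoints (P.filter (fun v => MvPolynomial.eval v f = 0)) ∧
    -- the output is the smallest Boolean polynomial that agrees with `f` on `P`
    (BoolInterp.IsBoolean (BoolInterp.nfByInterpolate f P) ∧
      (∀ v ∈ P, MvPolynomial.eval v (BoolInterp.nfByInterpolate f P) = MvPolynomial.eval v f) ∧
      ∀ q : MvPolynomial (Fin n) (ZMod 2), BoolInterp.IsBoolean q →
        (∀ v ∈ P, MvPolynomial.eval v q = MvPolynomial.eval v f) →
        BoolInterp.PolyGE MonomialOrder.lex q (BoolInterp.nfByInterpolate f P)) ∧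
    -- the output is the reduced normal form of `f` against every Gröbner basis of `I(P)`
    ∀ G : Finset (MvPolynomial (Fin n) (ZMod 2)),
      BoolInterp.IsGroebnerBasis MonomialOrder.lex G
        (MvPolynomial.vanishingIdeal (ZMod 2) (P : Set (Fin n → ZMod 2))) →
      BoolInterp.IsReducedNormalForm MonomialOrder.lex G f (BoolInterp.nfByInterpolate f P) ∧
      ∀ h : MvPolynomial (Fin n) (ZMod 2),
        f - h ∈ MvPolynomial.vanishingIdeal (ZMod 2) (P : Set (Fin n → ZMod 2)) →
        BoolInterp.IsReduced MonomialOrder.lex G h → h = BoolInterp.nfByInterpolate f P := by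
  refine ⟨BoolInterp.zeros_encodePoly hf P, ⟨BoolInterp.isBoolean_decodePoly _,
    fun v hv => BoolInterp.eval_nfByInterpolate hf hv, fun q _ hq => ?_⟩, fun G hG => ?_⟩
  · refine (BoolInterp.isReducedIdeal_nfByInterpolate f P).polyGE ?_
    exact BoolInterp.sub_mem_vanishingIdeal fun v hv =>
      (hq v hv).trans (BoolInterp.eval_nfByInterpolate hf hv).symm
  · have hr := BoolInterp.isReducedIdeal_nfByInterpolate f P
    have hf' := BoolInterp.sub_mem_vanishingIdeal (P := P) fun v hv =>
      (BoolInterp.eval_nfByInterpolate hf hv).symm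
    exact ⟨hr.isReducedNormalForm hG hf', fun h hfh hh => hr.eq_of_isReduced hG hf' hh hfh⟩
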